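/- Let $N\ge 1$, let $q\in\mathbb C^{\times}$ be not a root of unity, and let $A$ be a unital associative $\mathbb C$-algebra. Call a matrix $Z=(z_{ij})\in M_N(A)$ a \emph{$GL_q(N)$ matrix} if for all $i<i'$ and $j<j'$ the minor $\begin{pmatrix}z_{11}&z_{12}\\z_{21}&z_{22}\end{pmatrix}:=\begin{pmatrix}z_{ij}&z_{ij'}\\z_{i'j}&z_{i'j'}\end{pmatrix}$ satisfies $$z_{11}z_{12}=z_{12}z_{11},\quad z_{21}z_{22}=z_{22}z_{21},\quad z_{11}z_{21}=q^2z_{21}z_{11},\quad z_{12}z_{22}=q^2z_{22}z_{12},$$ $$z_{12}z_{21}=q^2z_{21}z_{12},\qquad z_{11}z_{22}-z_{12}z_{21}=z_{22}z_{11}-z_{21}z_{12}.$$ Let $w_0=s_{i_1}\cdots s_{i_l}$ be any reduced expression of the longest element of the symmetric group $S_N$, with $s_i=(i,i+1)$. Let $v_1,\dots,v_{N-1}$ and $a_1,\dots,a_l$ be invertible elements of $A$, and put $$T^+=\mathrm{diag}(1,v_1,\dots,v_{N-1}),\qquad U^+=x_{i_1}(a_1)\cdots x_{i_l}(a_l),\qquad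 x_i(a)=1+aE_{i,i+1}.$$ Write $a_{i,m}$ for the coordinate $a_p$ such that $p$ is the position of the $m$-th occurrence of $i$ in the word $(i_1,\dots,i_l)$. Put arrows between the coordinates $v_i,a_{i,m}$ as follows: $a_{i,m}\to v_i$ for all $i,m$; $a_{i,k}\to a_{i,m}$ whenever $a_{i,m}$ appears before $a_{i,k}$; $a_{i,m}\to a_{i-1,n}$ whenever $a_{i,m}$ appears before $a_{i-1,n}$; there are no other arrows. We say that two coordinates $x,y$ satisfy the \emph{arrow relation} if $xy=q^2yx$ when $x\to y$, $yx=q^2xy$ when $y\to x$, and $xy=yx$ when no arrow joins them. A \emph{triple} consists of coordinates $a_{i,m},a_{j,n},a_{i,k}$ that appear in this order in $U^+$, where $|i-j|=1$; its five coordinates are $v_i,v_j,a_{i,m},a_{j,n},a_{i,k}$. These five \emph{form a copy of $GL_q(3)$} if the $3\times3$ matrix $$\mathrm{diag}(1,v_j,v_i)\,x_2(a_{i,m})\,x_1(a_{j,n})\,x_2(a_{i,k})\ \ (j=i-1),\qquad \mathrm{diag}(1,v_i,v_j)\,x_1(a_{i,m})\,x_2(a_{j,n})\,x_1(a_{i,k})\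 \ (j=i+1)$$ is a $GL_q(3)$ matrix. Then: 1. $T^+U^+$ is a $GL_q(N)$ matrix if and only if the five coordinates of every triple form a copy of $GL_q(3)$ and any two coordinates that do not belong to a common triple satisfy the arrow relation. 2. Equivalently, $T^+U^+$ is a $GL_q(N)$ matrix if and only if any two of the coordinates $v_i,a_{i,m}$ satisfy the arrow relation. 3. The five coordinates of a triple form a copy of $GL_q(3)$ if and only if any two of them satisfy the arrow relation; that is, $a_{i,k}\to a_{i,m}$, $a_{i,m}\to v_i$, $a_{i,k}\to v_i$, $a_{j,n}\to v_j$, together with $a_{i,m}\to a_{j,n}$ if $j=i-1$, or $a_{j,n}\to a_{i,k}$ if $j=i+1$, and all other pairs among the five commute. -/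

import Mathlib

/-- The defining relations of the (rescaled) quantum group `GL_q(2)` for the `2 × 2` array
`z₁₁ z₁₂ / z₂₁ z₂₂`. -/
structure IsGLqTwo {A : Type*} [Ring A] [Algebra ℂ A] (q : ℂ) (z11 z12 z21 z22 : A) : Prop where
  row_one : z11 * z12 = z12 * z11
  row_two : z21 * z22 = z22 * z21
  col_one : z11 * z21 = q ^ 2 • (z21 * z11)
  col_two : z12 * z22 = q ^ 2 • (z22 * z12)
  anti : z12 * z21 = q ^ 2 • (z21 * z12)
  det : z11 * z22 - z12 * z21 = z22 * z11 - z21 * z12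

/-- `Z` is a `GL_q(N)` matrix: each of its `2 × 2` minors is a copy of `GL_q(2)`. -/
def IsGLqMatrix {A : Type*} [Ring A] [Algebra ℂ A] (q : ℂ) {N : ℕ}
    (Z : Matrix (Fin N) (Fin N) A) : Prop :=
  ∀ i i' j j' : Fin N, i < i' → j < j' → IsGLqTwo q (Z i j) (Z i j') (Z i' j) (Z i' j')

/-- The elementary unipotent matrix `x_i(a) = 1 + a E_{i,i+1}` of size `n + 1`.
(The index `i` runs over `0, …, n - 1`.) -/
def elemUnip {A : Type*} [Ring A] {n : ℕ} (i : Fin n) (a : A) :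
    Matrix (Fin (n + 1)) (Fin (n + 1)) A :=
  1 + Matrix.single i.castSucc i.succ a

/-- `U⁺ = x_{i_1}(a_1) x_{i_2}(a_2) ⋯ x_{i_m}(a_m)` for the word `ω = (i_1, …, i_m)`. -/
def unipProd {A : Type*} [Ring A] {n : ℕ} (ω : List (Fin n)) (a : Fin ω.length → A) :
    Matrix (Fin (n + 1)) (Fin (n + 1)) A :=
  (List.ofFn fun p : Fin ω.length => elemUnip (ω.get p) (a p)).prod

/-- `T⁺ = diag(1, v_1, …, v_n)`. -/
def torusPlus {A : Type*} [Ring A] {n : ℕ} (v : Fin n → A) :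
    Matrix (Fin (n + 1)) (Fin (n + 1)) A :=
  Matrix.diagonal (Fin.cons (1 : A) v)

/-- The simple transposition `s_i = (i, i+1)` in the symmetric group on `n + 1` letters. -/
def simpleTransp {n : ℕ} (i : Fin n) : Equiv.Perm (Fin (n + 1)) :=
  Equiv.swap i.castSucc i.succ

/-- The word `ω` is a reduced expression of `w`: the product of its simple transpositions is `w`,
and no shorter word has this property. -/
def IsReducedExpr {n : ℕ} (ω : List (Fin n)) (w : Equiv.Perm (Fin (n + 1))) : Prop :=
  (ω.map simpleTransp).prod = w ∧
    ∀ ω' : List (Fin n), (ω'.map simpleTransp).prod = w → ω.length ≤ ω'.length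

/-- Two letters are adjacent, `|i - j| = 1`. -/
def AdjLetters {n : ℕ} (i j : Fin n) : Prop :=
  (i : ℕ) = j + 1 ∨ (j : ℕ) = i + 1

/-- The positions `p < r < s` of the word carry letters `i, j, i` with `|i - j| = 1`, so that
`a_p, a_r, a_s` is a triple `a_{i,m}, a_{j,n}, a_{i,k}` appearing in this order. -/
def IsTriple {n : ℕ} (ω : List (Fin n)) (p r s : Fin ω.length) : Prop :=
  p < r ∧ r < s ∧ ω.get p = ω.get s ∧ AdjLetters (ω.get p) (ω.get r)

/-- The `3 × 3` matrix `T⁺U⁺` attached to the triple `a_{i,m}, a_{j,n}, a_{i,k}` and to `v_i, v_j`: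
`diag(1, v_j, v_i) x_2(a_{i,m}) x_1(a_{j,n}) x_2(a_{i,k})` if `j = i - 1`, and
`diag(1, v_i, v_j) x_1(a_{i,m}) x_2(a_{j,n}) x_1(a_{i,k})` if `j = i + 1`. -/
def tripleMatrix {A : Type*} [Ring A] {n : ℕ} (ω : List (Fin n)) (v : Fin n → A)
    (a : Fin ω.length → A) (p r s : Fin ω.length) : Matrix (Fin 3) (Fin 3) A :=
  if ω.get r < ω.get p then
    torusPlus ![v (ω.get r), v (ω.get p)] *
      unipProd ([1, 0, 1] : List (Fin 2)) ![a p, a r, a s]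
  else
    torusPlus ![v (ω.get p), v (ω.get r)] *
      unipProd ([0, 1, 0] : List (Fin 2)) ![a p, a r, a s]

/-- Labels of the coordinates of `T⁺U⁺`: `tor i` stands for `v_i`, and `unip p` for the coordinate
`a_p` at position `p` of the word (that is, for `a_{i,m}` if `p` is the `m`-th occurrence of the
letter `i`). -/
inductive Coord {n : ℕ} (ω : List (Fin n)) : Type where
  | tor (i : Fin n) : Coord ω
  | unip (p : Fin ω.length) : Coord ω

/-- The value of a coordinate in the algebra. -/
def Coord.val {A : Type*} {n : ℕ} {ω : List (Fin n)} (v : Fin n → A) (a : Fin ω.length → A) :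
    Coord ω → A
  | .tor i => v i
  | .unip p => a p

/-- The five coordinates `v_i, v_j, a_{i,m}, a_{j,n}, a_{i,k}` of the triple at `p, r, s`. -/
def Coord.MemTriple {n : ℕ} {ω : List (Fin n)} (p r s : Fin ω.length) : Coord ω → Prop
  | .tor i => i = ω.get p ∨ i = ω.get r
  | .unip t => t = p ∨ t = r ∨ t = s

/-- The arrows `x → y`: an arrow from each `a_{i,m}` to `v_i`, to each earlier `a_{i,k}`, and to
each later `a_{i-1,n}`; there are no other arrows. -/
def Coord.Arrow {n : ℕ} {ω : List (Fin n)} : Coord ω → Coord ω → Prop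
  | .unip p, .tor i => ω.get p = i
  | .unip p, .unip r =>
      (r < p ∧ ω.get r = ω.get p) ∨ (p < r ∧ (ω.get p : ℕ) = ω.get r + 1)
  | .tor _, _ => False

/-- The relation that the arrows prescribe for the coordinates `x` and `y`: an arrow `x → y` means
`xy = q² yx`, and coordinates that are not joined by an arrow commute. -/
def ArrowRel {A : Type*} [Ring A] [Algebra ℂ A] (q : ℂ) {n : ℕ} {ω : List (Fin n)}
    (v : Fin n → A) (a : Fin ω.length → A) (x y : Coord ω) : Prop :=
  (x.Arrow y → x.val v a * y.val v a = q ^ 2 • (y.val v a * x.val v a)) ∧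
  (y.Arrow x → y.val v a * x.val v a = q ^ 2 • (x.val v a * y.val v a)) ∧
  (¬ x.Arrow y → ¬ y.Arrow x → x.val v a * y.val v a = y.val v a * x.val v a)

/-! The proof is an induction on the word from its right end. Let Z = M x_i(a), where M is T⁺ times
the earlier factors. Then Z is a GL_q matrix iff M is one and `a` commutes with the entries of M in
every column except i+1, where a·m = q² m·a. `colWeight` records this twist.

Under these column relations, right multiplication by x_i(a) is a column operation that preserves
and reflects the quantum relations (`isGLqMatrix_mul_elemUnip_iff`). They are in turn equivalent to
the arrow relations between `a` and all earlier coordinates: one direction multiplies out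
(`mul_chainProd_eq_mul_colWeight`), the other compares two factorizations of one matrix
(`relations_of_mul_eq_colWeight`).

The hard point is that Z forces the column relations (`IsGLqMatrix.mul_last_eq`). The left span of
the first k rows of Z is stable under operators built from right multiplication by entries of Z
(`IsGLqMatrix.mem_rowSpan`). Since the word is reduced and its coordinates are invertible, the
pivots of such spans follow the permutation of the prefix, as in a Bruhat cell. For a suitable k,
every vector w in the span that vanishes right of column i+1 satisfies w_{i+1} = w_i a, and some
such w has w_i = 1. Applying the operators to this w yields the column relations.

A triple is the same statement for a word i j i in rank two, and the criterion by triples combines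
the two cases. -/

/-! ### Elementary unipotent factors. -/

theorem elemUnip_apply {A : Type*} [Ring A] {n : ℕ} (i : Fin n) (a : A) (k l : Fin (n + 1)) :
    elemUnip i a k l =
      (if k = l then 1 else 0) + if l = i.succ then (if k = i.castSucc then a else 0) else 0 := by
  simp only [elemUnip, Matrix.add_apply, Matrix.one_apply, Matrix.single_apply]
  congr 1
  grind

theorem vecMul_elemUnip_apply {A : Type*} [Ring A] {n : ℕ} (w : Fin (n + 1) → A) (i : Fin n)
    (a : A) (l : Fin (n + 1)) :
    Matrix.vecMul w (elemUnip i a) l = w l + if l = i.succ then w i.castSucc * a else 0 := by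
  rw [elemUnip, Matrix.vecMul_add, Matrix.vecMul_one, Pi.add_apply]
  congr 1
  simp only [Matrix.vecMul, dotProduct, Matrix.single_apply]
  split_ifs with h
  · subst h
    rw [Finset.sum_eq_single i.castSucc] <;> grind
  · exact Finset.sum_eq_zero fun k _ => by grind

theorem mul_elemUnip_apply {A : Type*} [Ring A] {n : ℕ} (M : Matrix (Fin (n + 1)) (Fin (n + 1)) A)
    (i : Fin n) (a : A) (k l : Fin (n + 1)) :
    (M * elemUnip i a) k l = M k l + if l = i.succ then M k i.castSucc * a else 0 := by
  rw [Matrix.mul_apply_eq_vecMul, vecMul_elemUnip_apply]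

theorem elemUnip_mul_neg {A : Type*} [Ring A] {n : ℕ} (i : Fin n) (a : A) :
    elemUnip i a * elemUnip i (-a) = 1 := by
  have h : i.castSucc ≠ i.succ := i.castSucc_lt_succ.ne
  simp [elemUnip, mul_add, add_mul, h.symm, add_assoc, ← Matrix.single_add]

/-- The product of the elementary unipotent matrices attached to a list of letters and
coordinates. -/
def chainProd {A : Type*} [Ring A] {n : ℕ} (L : List (Fin n × A)) :
    Matrix (Fin (n + 1)) (Fin (n + 1)) A :=
  (L.map fun x => elemUnip x.1 x.2).prod

theorem chainProd_concat {A : Type*} [Ring A] {n : ℕ} (L : List (Fin n × A)) (x : Fin n × A) :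
    chainProd (L ++ [x]) = chainProd L * elemUnip x.1 x.2 := by
  simp [chainProd]

/-! ### Arrow relations as twisted commutation. -/

/-- The element `a`, rescaled by `q²` in column `i + 1`. -/
def colWeight {A : Type*} [Ring A] [Algebra ℂ A] (q : ℂ) {n : ℕ} (i : Fin n) (a : A)
    (j : Fin (n + 1)) : A :=
  if j = i.succ then q ^ 2 • a else a

/-- The arrow relations for the coordinates `v` and for the list `L` of letters and coordinates. -/
structure ListArrowRel {A : Type*} [Ring A] [Algebra ℂ A] (q : ℂ) {n : ℕ} (v : Fin n → A)
    (L : List (Fin n × A)) : Prop where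
  tor : ∀ i j, v i * v j = v j * v i
  mixed : ∀ x ∈ L, ∀ j, x.2 * v j = v j * colWeight q x.1 x.2 j.succ
  unip : L.Pairwise fun y x =>
    y.2 * colWeight q x.1 x.2 y.1.succ = colWeight q x.1 x.2 y.1.castSucc * y.2

theorem listArrowRel_concat {A : Type*} [Ring A] [Algebra ℂ A] {q : ℂ} {n : ℕ} {v : Fin n → A}
    {L : List (Fin n × A)} {x : Fin n × A} :
    ListArrowRel q v (L ++ [x]) ↔ ListArrowRel q v L ∧
      (∀ j, x.2 * v j = v j * colWeight q x.1 x.2 j.succ) ∧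
      ∀ y ∈ L, y.2 * colWeight q x.1 x.2 y.1.succ = colWeight q x.1 x.2 y.1.castSucc * y.2 := by
  constructor
  · rintro ⟨h1, h2, h3⟩
    rw [List.pairwise_append] at h3
    exact ⟨⟨h1, fun y hy => h2 y (by simp [hy]), h3.1⟩, h2 x (by simp),
      fun y hy => h3.2.2 y hy x (by simp)⟩
  · rintro ⟨⟨h1, h2, h3⟩, h4, h5⟩
    refine ⟨h1, fun y hy => ?_, List.pairwise_append.2 ⟨h3, by simp, ?_⟩⟩
    · rcases List.mem_append.1 hy with hy | hy
      · exact h2 y hy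
      · rw [List.mem_singleton.1 hy]
        exact h4
    · intro y hy z hz
      rw [List.mem_singleton.1 hz]
      exact h5 y hy

theorem torusPlus_apply {A : Type*} [Ring A] {n : ℕ} (v : Fin n → A) (k j : Fin (n + 1)) :
    torusPlus v k j = if k = j then (Fin.cons (1 : A) v : Fin (n + 1) → A) j else 0 := by
  rw [torusPlus, Matrix.diagonal_apply]
  split_ifs with h
  · rw [h]
  · rfl

/-- Each factor carries the twist of its left column to that of its right column, so `a` can be
moved through the product one factor at a time. -/
theorem mul_chainProd_eq_mul_colWeight {A : Type*} [Ring A] [Algebra ℂ A] {q : ℂ} {n : ℕ}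
    {v : Fin n → A} {i : Fin n} {a : A} (hv : ∀ j, a * v j = v j * colWeight q i a j.succ)
    (L : List (Fin n × A))
    (hL : ∀ y ∈ L, y.2 * colWeight q i a y.1.succ = colWeight q i a y.1.castSucc * y.2)
    (k j : Fin (n + 1)) :
    a * (torusPlus v * chainProd L) k j =
      (torusPlus v * chainProd L) k j * colWeight q i a j := by
  induction L using List.reverseRecOn generalizing k j with
  | nil =>
    simp only [chainProd, List.map_nil, List.prod_nil, mul_one, torusPlus_apply]
    split_ifs with h
    · cases j using Fin.cases with
      | zero => simp [colWeight, (Fin.succ_ne_zero i).symm]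
      | succ j => simpa using hv j
    · simp
  | append_singleton L y ih =>
    have ih' := ih fun z hz => hL z (by simp [hz])
    have hy := hL y (by simp)
    rw [chainProd_concat, ← mul_assoc, mul_elemUnip_apply]
    split_ifs with h
    · subst h
      rw [mul_add, add_mul, ih', ← mul_assoc, ih', mul_assoc, mul_assoc, hy]
    · rw [add_zero, ih']

/-! ### Column operations on quantum matrices. -/

/-- After `a` is moved to the right, each relation of the sheared minor is the original one plus
multiples of other original relations by `a`. Only the second column relation has an `a²` term, and
`col_one` takes care of it. -/
theorem IsGLqTwo.shear_iff {A : Type*} [Ring A] [Algebra ℂ A] {q : ℂ} {a c c' d d' : A}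
    (hd : a * d = d * a) (hd' : a * d' = d' * a) (hc : a * c = q ^ 2 • (c * a))
    (hc' : a * c' = q ^ 2 • (c' * a)) :
    IsGLqTwo q d (c + d * a) d' (c' + d' * a) ↔ IsGLqTwo q d c d' c' := by
  have e1 : (c + d * a) * d' = c * d' + d * d' * a := by
    rw [add_mul, mul_assoc, hd', mul_assoc]
  have e2 : (c' + d' * a) * d = c' * d + d' * d * a := by
    rw [add_mul, mul_assoc, hd, mul_assoc]
  have e3 : (c + d * a) * d = c * d + d * d * a := by
    rw [add_mul, mul_assoc, hd, mul_assoc]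
  have e4 : (c' + d' * a) * d' = c' * d' + d' * d' * a := by
    rw [add_mul, mul_assoc, hd', mul_assoc]
  have e5 : (c + d * a) * (c' + d' * a) =
      c * c' + (c * d' + q ^ 2 • (d * c')) * a + d * d' * (a * a) := by
    linear_combination
      (norm := (simp only [mul_add, add_mul, mul_assoc, mul_smul_comm, smul_mul_assoc]; module))
      d * hc' + d * hd' * a
  have e6 : (c' + d' * a) * (c + d * a) =
      c' * c + (c' * d + q ^ 2 • (d' * c)) * a + d' * d * (a * a) := by
    linear_combination
      (norm := (simp only [mul_add, add_mul, mul_assoc, mul_smul_comm, smul_mul_assoc]; module))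
      d' * hc + d' * hd * a
  constructor
  · rintro ⟨h1, h2, h3, h4, h5, h6⟩
    have r1 : d * c = c * d := by
      linear_combination (norm := (simp only [mul_add, mul_assoc]; module)) h1 + e3
    have r2 : d' * c' = c' * d' := by
      linear_combination (norm := (simp only [mul_add, mul_assoc]; module)) h2 + e4
    have r5 : c * d' = q ^ 2 • (d' * c) := by
      rw [e1, h3] at h5
      linear_combination (norm := (simp only [mul_add, mul_assoc, smul_mul_assoc]; module)) h5
    have r6 : d * c' - c * d' = c' * d - d' * c := by
      rw [e1, e2] at h6
      linear_combination (norm := (simp only [mul_add, mul_assoc]; module)) h6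
    refine ⟨r1, r2, h3, ?_, r5, r6⟩
    rw [e5, e6, h3] at h4
    linear_combination
        (norm := (simp only [add_mul, sub_mul, mul_assoc, smul_mul_assoc]; module))
        h4 - q ^ 2 • (r6 * a) - (1 + q ^ 2) • (r5 * a)
  · rintro ⟨h1, h2, h3, h4, h5, h6⟩
    refine ⟨?_, ?_, h3, ?_, ?_, ?_⟩
    · rw [e3, mul_add, h1, mul_assoc]
    · rw [e4, mul_add, h2, mul_assoc]
    · rw [e5, e6, h3]
      linear_combination
        (norm := (simp only [add_mul, sub_mul, mul_assoc, smul_mul_assoc]; module))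
        h4 + q ^ 2 • (h6 * a) + (1 + q ^ 2) • (h5 * a)
    · rw [e1, h3, h5]
      simp only [mul_add, mul_assoc, smul_mul_assoc, smul_add]
    · rw [e1, e2]
      linear_combination (norm := (simp only [mul_add, mul_assoc]; module)) h6

/-- As `a` commutes with the untouched column, the relations are additive in the other column, and
the added part is a known minor times `a`. The exception is the quadratic relation inside the
changed column, hence the two hypotheses on it. -/
theorem IsGLqTwo.add_right_iff {A : Type*} [Ring A] [Algebra ℂ A] {q : ℂ} {a c c' d d' p r : A}
    (hp : a * p = p * a) (hr : a * r = r * a) (h : IsGLqTwo q p d r d')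
    (hcol : c * c' = q ^ 2 • (c' * c))
    (hcol' : (c + d * a) * (c' + d' * a) = q ^ 2 • ((c' + d' * a) * (c + d * a))) :
    IsGLqTwo q p (c + d * a) r (c' + d' * a) ↔ IsGLqTwo q p c r c' := by
  have e : ∀ {x y z : A}, a * z = z * a → (x + y * a) * z = x * z + y * z * a := by
    intro x y z hz
    rw [add_mul, mul_assoc, hz, mul_assoc]
  obtain ⟨h1, h2, h3, h4, h5, h6⟩ := h
  have h6' : p * d' * a - d * r * a = d' * p * a - r * d * a := by
    rw [← sub_mul, h6, sub_mul]
  constructor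
  · rintro ⟨k1, k2, k3, k4, k5, k6⟩
    refine ⟨?_, ?_, h3, hcol, ?_, ?_⟩
    · rwa [e hp, mul_add, ← mul_assoc, h1, add_left_inj] at k1
    · rwa [e hr, mul_add, ← mul_assoc, h2, add_left_inj] at k2
    · rwa [e hr, mul_add, ← mul_assoc, h5, smul_add, smul_mul_assoc, add_left_inj] at k5
    · rw [e hp, e hr] at k6
      linear_combination (norm := (simp only [mul_add, mul_assoc]; module)) k6 - h6'
  · rintro ⟨k1, k2, k3, k4, k5, k6⟩
    refine ⟨?_, ?_, h3, hcol', ?_, ?_⟩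
    · rw [e hp, mul_add, ← mul_assoc, h1, k1]
    · rw [e hr, mul_add, ← mul_assoc, h2, k2]
    · rw [e hr, mul_add, ← mul_assoc, h5, smul_add, smul_mul_assoc, k5]
    · rw [e hp, e hr]
      linear_combination (norm := (simp only [mul_add, mul_assoc]; module)) k6 + h6'

theorem IsGLqTwo.add_left_iff {A : Type*} [Ring A] [Algebra ℂ A] {q : ℂ} {a c c' d d' p r : A}
    (hp : a * p = p * a) (hr : a * r = r * a) (h : IsGLqTwo q d p d' r)
    (hcol : c * c' = q ^ 2 • (c' * c))
    (hcol' : (c + d * a) * (c' + d' * a) = q ^ 2 • ((c' + d' * a) * (c + d * a))) :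
    IsGLqTwo q (c + d * a) p (c' + d' * a) r ↔ IsGLqTwo q c p c' r := by
  have e : ∀ {x y z : A}, a * z = z * a → (x + y * a) * z = x * z + y * z * a := by
    intro x y z hz
    rw [add_mul, mul_assoc, hz, mul_assoc]
  obtain ⟨h1, h2, h3, h4, h5, h6⟩ := h
  have h6' : d * r * a - p * d' * a = r * d * a - d' * p * a := by
    rw [← sub_mul, h6, sub_mul]
  constructor
  · rintro ⟨k1, k2, k3, k4, k5, k6⟩
    refine ⟨?_, ?_, hcol, h4, ?_, ?_⟩
    · rwa [e hp, mul_add, ← mul_assoc, ← h1, add_left_inj] at k1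
    · rwa [e hr, mul_add, ← mul_assoc, ← h2, add_left_inj] at k2
    · rwa [e hp, mul_add, ← mul_assoc, h5, smul_add, smul_mul_assoc, add_left_inj] at k5
    · rw [e hp, e hr] at k6
      linear_combination (norm := (simp only [mul_add, mul_assoc]; module)) k6 - h6'
  · rintro ⟨k1, k2, k3, k4, k5, k6⟩
    refine ⟨?_, ?_, hcol', h4, ?_, ?_⟩
    · rw [e hp, mul_add, ← mul_assoc, ← h1, k1]
    · rw [e hr, mul_add, ← mul_assoc, ← h2, k2]
    · rw [e hp, mul_add, ← mul_assoc, h5, smul_add, smul_mul_assoc, k5]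
    · rw [e hp, e hr]
      linear_combination (norm := (simp only [mul_add, mul_assoc]; module)) k6 + h6'

theorem isGLqMatrix_mul_elemUnip_iff {A : Type*} [Ring A] [Algebra ℂ A] {q : ℂ} {n : ℕ}
    {M : Matrix (Fin (n + 1)) (Fin (n + 1)) A} {i : Fin n} {a : A}
    (hM : ∀ k j, a * M k j = M k j * colWeight q i a j) :
    IsGLqMatrix q (M * elemUnip i a) ↔ IsGLqMatrix q M := by
  have hcomm : ∀ k j, j ≠ i.succ → a * M k j = M k j * a := fun k j hj => by
    simpa [colWeight, hj] using hM k j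
  have hsucc : ∀ k, a * M k i.succ = q ^ 2 • (M k i.succ * a) := fun k => by
    simpa [colWeight] using hM k i.succ
  have hi : i.castSucc ≠ i.succ := i.castSucc_lt_succ.ne
  have e1 : ∀ k, (M * elemUnip i a) k i.succ = M k i.succ + M k i.castSucc * a := fun k => by
    simp [mul_elemUnip_apply]
  have e2 : ∀ k j, j ≠ i.succ → (M * elemUnip i a) k j = M k j := fun k j hj => by
    simp [mul_elemUnip_apply, hj]
  have pair : ∀ k l, IsGLqTwo q ((M * elemUnip i a) k i.castSucc) ((M * elemUnip i a) k i.succ)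
      ((M * elemUnip i a) l i.castSucc) ((M * elemUnip i a) l i.succ) ↔
      IsGLqTwo q (M k i.castSucc) (M k i.succ) (M l i.castSucc) (M l i.succ) := fun k l => by
    rw [e1, e1, e2 _ _ hi, e2 _ _ hi]
    exact IsGLqTwo.shear_iff (hcomm _ _ hi) (hcomm _ _ hi) (hsucc _) (hsucc _)
  -- A minor using column i+1 but not column i is compared through the auxiliary minor with column i
  -- in place of i+1, which the operation leaves unchanged.
  have key : ∀ k l j j', j < j' →
      IsGLqTwo q (M k i.castSucc) (M k i.succ) (M l i.castSucc) (M l i.succ) →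
      (j' = i.succ → j < i.castSucc →
        IsGLqTwo q (M k j) (M k i.castSucc) (M l j) (M l i.castSucc)) →
      (j = i.succ → IsGLqTwo q (M k i.castSucc) (M k j') (M l i.castSucc) (M l j')) →
      (IsGLqTwo q ((M * elemUnip i a) k j) ((M * elemUnip i a) k j')
        ((M * elemUnip i a) l j) ((M * elemUnip i a) l j') ↔
      IsGLqTwo q (M k j) (M k j') (M l j) (M l j')) := by
    intro k l j j' hj h1 h2 h3
    have h4 := (pair k l).2 h1
    rw [e1, e1] at h4
    by_cases hj' : j' = i.succ
    · subst hj'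
      rcases lt_or_eq_of_le (show j ≤ i.castSucc from Fin.le_castSucc_iff.2 hj) with h | h
      · rw [e1, e1, e2 _ _ hj.ne, e2 _ _ hj.ne]
        exact IsGLqTwo.add_right_iff (hcomm _ _ hj.ne) (hcomm _ _ hj.ne) (h2 rfl h) h1.col_two
          h4.col_two
      · subst h
        exact pair k l
    · by_cases hj2 : j = i.succ
      · subst hj2
        rw [e1, e1, e2 _ _ hj', e2 _ _ hj']
        exact IsGLqTwo.add_left_iff (hcomm _ _ hj') (hcomm _ _ hj') (h3 rfl) h1.col_two
          h4.col_two
      · rw [e2 _ _ hj', e2 _ _ hj', e2 _ _ hj2, e2 _ _ hj2]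
  have hlt := i.castSucc_lt_succ
  constructor
  · intro h k l j j' hkl hj
    have h1 := (pair k l).1 (h k l _ _ hkl hlt)
    refine (key k l j j' hj h1 (fun _ hji => ?_) fun hji => ?_).1 (h k l j j' hkl hj)
    · have := h k l _ _ hkl hji
      rwa [e2 _ _ (hji.trans hlt).ne, e2 _ _ (hji.trans hlt).ne, e2 _ _ hi, e2 _ _ hi] at this
    · subst hji
      have := h k l _ _ hkl (hlt.trans hj)
      rwa [e2 _ _ hj.ne', e2 _ _ hj.ne', e2 _ _ hi, e2 _ _ hi] at this
  · intro h k l j j' hkl hj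
    refine (key k l j j' hj (h k l _ _ hkl hlt) (fun _ hji => h k l _ _ hkl hji) fun hji => ?_).2
      (h k l j j' hkl hj)
    exact h k l _ _ hkl (hlt.trans (hji ▸ hj))

/-! ### Row spans of quantum matrices. -/

/-- The left span of the first `k` rows of a matrix. -/
def rowSpan {A : Type*} [Ring A] {N : ℕ} (Z : Matrix (Fin N) (Fin N) A) (k : ℕ) :
    Submodule A (Fin N → A) :=
  Submodule.span A (Z '' {r | (r : ℕ) < k})

theorem row_mem_rowSpan {A : Type*} [Ring A] {N : ℕ} (Z : Matrix (Fin N) (Fin N) A) {k : ℕ}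
    {r : Fin N} (hr : (r : ℕ) < k) : Z r ∈ rowSpan Z k :=
  Submodule.subset_span ⟨r, hr, rfl⟩

theorem mem_rowSpan_mul_iff {A : Type*} [Ring A] {N : ℕ} {Z X : Matrix (Fin N) (Fin N) A} {k : ℕ}
    {w : Fin N → A} :
    w ∈ rowSpan (Z * X) k ↔ ∃ u ∈ rowSpan Z k, Matrix.vecMul u X = w := by
  have : rowSpan (Z * X) k = (rowSpan Z k).map (Matrix.vecMulLinear X) := by
    rw [rowSpan, rowSpan, Submodule.map_span]
    exact congrArg _ (Set.image_image (Matrix.vecMulLinear X) Z {r | (r : ℕ) < k}).symm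
  rw [this]
  rfl

theorem IsGLqMatrix.row_comm {A : Type*} [Ring A] [Algebra ℂ A] {q : ℂ} {N : ℕ}
    {Z : Matrix (Fin N) (Fin N) A} (hZ : IsGLqMatrix q Z) (r c j : Fin N) :
    Z r c * Z r j = Z r j * Z r c := by
  wlog h : c < j generalizing c j
  · rcases (not_lt.1 h).eq_or_lt with h | h
    · rw [h]
    · exact (this j c h).symm
  · rcases eq_or_ne r c with rfl | hr
    · exact (hZ _ _ _ _ h h).row_one
    · rcases lt_or_gt_of_ne hr with hr | hr
      · exact (hZ _ _ _ _ hr h).row_one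
      · exact (hZ _ _ _ _ hr h).row_two

theorem IsGLqMatrix.col_mul {A : Type*} [Ring A] [Algebra ℂ A] {q : ℂ} {N : ℕ}
    {Z : Matrix (Fin N) (Fin N) A} (hZ : IsGLqMatrix q Z) {r m : Fin N} (c : Fin N) (h : r < m) :
    Z r c * Z m c = q ^ 2 • (Z m c * Z r c) := by
  rcases eq_or_ne r c with rfl | hr
  · exact (hZ _ _ _ _ h h).col_one
  · rcases lt_or_gt_of_ne hr with hr | hr
    · exact (hZ _ _ _ _ h hr).col_two
    · exact (hZ _ _ _ _ h hr).col_one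

/-- All relations in one R-matrix-like formula. The left coefficients depend only on the columns and
the right ones only on the rows, so with `m`, `c` fixed and `j` varying the right side is a left
combination of rows `r` and `m`, with row `m` present only if `m ≤ r`. -/
theorem IsGLqMatrix.mul_smul_eq {A : Type*} [Ring A] [Algebra ℂ A] {q : ℂ} {N : ℕ}
    {Z : Matrix (Fin N) (Fin N) A} (hZ : IsGLqMatrix q Z) (r m c j : Fin N) :
    (if j < c then q ^ 2 else 1 : ℂ) • (Z r j * Z m c) -
      (if j < c then q ^ 2 - 1 else 0 : ℂ) • (Z r c * Z m j) =
    (if r ≤ m then q ^ 2 else 1 : ℂ) • (Z m c * Z r j) -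
      (if m ≤ r then q ^ 2 - 1 else 0 : ℂ) • (Z r c * Z m j) := by
  rcases lt_trichotomy r m with h | h | h <;> rcases lt_trichotomy j c with h' | h' | h'
  · have := hZ _ _ _ _ h h'
    simp only [h', h.le, h.not_ge, if_true, if_false]
    linear_combination (norm := module) q ^ 2 • this.det + this.anti
  · subst h'
    simp only [lt_irrefl, h.le, h.not_ge, if_true, if_false]
    linear_combination (norm := module) hZ.col_mul j h
  · have := hZ _ _ _ _ h h'
    simp only [h'.not_gt, h.le, h.not_ge, if_true, if_false]
    linear_combination (norm := module) this.anti
  · subst h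
    have : Z r j * Z r c = Z r c * Z r j := hZ.row_comm _ _ _
    simp only [h', le_refl, if_true, this]
  · subst h h'
    simp only [lt_irrefl, le_refl, if_true, if_false]
    module
  · subst h
    have : Z r j * Z r c = Z r c * Z r j := hZ.row_comm _ _ _
    simp only [h'.not_gt, le_refl, if_true, if_false, this]
    module
  · have := hZ _ _ _ _ h h'
    simp only [h', h.le, h.not_ge, if_true, if_false]
    linear_combination (norm := module) - this.anti
  · subst h'
    simp only [lt_irrefl, h.le, h.not_ge, if_true, if_false]
    linear_combination (norm := module) -hZ.col_mul j h
  · have := hZ _ _ _ _ h h'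
    simp only [h'.not_gt, h.le, h.not_ge, if_true, if_false]
    linear_combination (norm := module) -this.det - this.anti

/-- The operator is left `A`-linear in `w`, so it suffices to test it on rows, where
`IsGLqMatrix.mul_smul_eq` involves no row of larger index than the given one. -/
theorem IsGLqMatrix.mem_rowSpan {A : Type*} [Ring A] [Algebra ℂ A] {q : ℂ} {N : ℕ}
    {Z : Matrix (Fin N) (Fin N) A} (hZ : IsGLqMatrix q Z) (m c : Fin N) {k : ℕ}
    {w : Fin N → A} (hw : w ∈ rowSpan Z k) :
    (fun j => (if j < c then q ^ 2 else 1 : ℂ) • (w j * Z m c) -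
      (if j < c then q ^ 2 - 1 else 0 : ℂ) • (w c * Z m j)) ∈ rowSpan Z k := by
  induction hw using Submodule.span_induction with
  | mem w h =>
    obtain ⟨r, hr, rfl⟩ := h
    simp only [Set.mem_ofPred_eq] at hr
    have : (fun j => (if j < c then q ^ 2 else 1 : ℂ) • (Z r j * Z m c) -
        (if j < c then q ^ 2 - 1 else 0 : ℂ) • (Z r c * Z m j)) =
        ((if r ≤ m then q ^ 2 else 1 : ℂ) • Z m c) • Z r -
        ((if m ≤ r then q ^ 2 - 1 else 0 : ℂ) • Z r c) • Z m := by
      ext j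
      rw [hZ.mul_smul_eq]
      simp only [Pi.sub_apply, Pi.smul_apply, smul_eq_mul, smul_mul_assoc]
    rw [this]
    refine Submodule.sub_mem _ (Submodule.smul_mem _ _ (row_mem_rowSpan Z hr)) ?_
    split_ifs with h
    · exact Submodule.smul_mem _ _ (row_mem_rowSpan Z (lt_of_le_of_lt h hr))
    · simp
  | zero =>
    convert Submodule.zero_mem (rowSpan Z k) using 1
    ext j
    simp
  | add x y _ _ hx hy =>
    convert Submodule.add_mem _ hx hy using 1
    ext j
    simp only [Pi.add_apply, add_mul]
    module
  | smul b x _ hx =>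
    convert Submodule.smul_mem _ b hx using 1
    ext j
    simp only [Pi.smul_apply, smul_eq_mul, mul_sub, mul_smul_comm, mul_assoc]

/-! ### Pivots of row spans. -/

/-- The row span `W` has pivots exactly in the columns where `P` holds: its elements with zero
entries right of `j` take the value `1` at `j` if `P j`, and vanish at `j` otherwise. -/
structure IsEchelon {A : Type*} [Ring A] {N : ℕ} (W : Submodule A (Fin N → A))
    (P : Fin N → Prop) : Prop where
  exists_pivot : ∀ j, P j → ∃ w ∈ W, w j = 1 ∧ ∀ m, j < m → w m = 0
  eq_zero : ∀ j, ¬ P j → ∀ w ∈ W, (∀ m, j < m → w m = 0) → w j = 0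

theorem isEchelon_torusPlus {A : Type*} [Ring A] {n : ℕ} {v : Fin n → A}
    (hv : ∀ i, IsUnit (v i)) (k : ℕ) :
    IsEchelon (rowSpan (torusPlus v) k) fun j => (j : ℕ) < k := by
  constructor
  · intro j hj
    have hu : IsUnit ((Fin.cons (1 : A) v : Fin (n + 1) → A) j) := by
      cases j using Fin.cases with
      | zero => exact isUnit_one
      | succ j => simpa using hv j
    obtain ⟨b, hb⟩ := hu.exists_left_inv
    refine ⟨b • torusPlus v j, Submodule.smul_mem _ _ (row_mem_rowSpan _ hj), ?_, ?_⟩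
    · simpa [torusPlus_apply] using hb
    · intro m hm
      simp [torusPlus_apply, hm.ne]
  · intro j hj w hw hz
    clear hz
    induction hw using Submodule.span_induction with
    | mem w h =>
      obtain ⟨r, hr, rfl⟩ := h
      have : r ≠ j := by
        rintro rfl
        exact hj hr
      simp [torusPlus_apply, this]
    | zero => rfl
    | add x y _ _ hx hy => simp [hx, hy]
    | smul b x _ hx => simp [hx]

/-- A pivot at i without one at i+1 moves to i+1, because the new entry there is the unit `a`. If
both or neither of the columns are pivots, nothing changes; the hypothesis `hP` excludes a pivot at
i+1 alone. -/
theorem IsEchelon.mul_elemUnip {A : Type*} [Ring A] {n : ℕ}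
    {Z : Matrix (Fin (n + 1)) (Fin (n + 1)) A} {k : ℕ} {P : Fin (n + 1) → Prop}
    (h : IsEchelon (rowSpan Z k) P) {i : Fin n} (hP : P i.succ → P i.castSucc) {a : A}
    (ha : IsUnit a) :
    IsEchelon (rowSpan (Z * elemUnip i a) k) fun j => P (simpleTransp i j) := by
  have hlt := i.castSucc_lt_succ
  have out : ∀ j, j ≠ i.castSucc → j ≠ i.succ → simpleTransp i j = j := fun j h1 h2 =>
    Equiv.swap_apply_of_ne_of_ne h1 h2
  have e1 : simpleTransp i i.castSucc = i.succ := Equiv.swap_apply_left _ _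
  have e2 : simpleTransp i i.succ = i.castSucc := Equiv.swap_apply_right _ _
  obtain ⟨b, hb⟩ := ha.exists_left_inv
  have gt : ∀ {m : Fin (n + 1)}, i.castSucc < m → m ≠ i.succ → i.succ < m := fun h1 h2 =>
    lt_of_le_of_ne (Fin.castSucc_lt_iff_succ_le.1 h1) h2.symm
  have span : ∀ w ∈ rowSpan Z k, Matrix.vecMul w (elemUnip i a) ∈ rowSpan (Z * elemUnip i a) k :=
    fun w hw => mem_rowSpan_mul_iff.2 ⟨w, hw, rfl⟩
  constructor
  · intro j hj
    have both : P i.castSucc → P i.succ →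
        ∃ w ∈ rowSpan Z k, w i.castSucc = 0 ∧ w i.succ = 1 ∧ ∀ m, i.succ < m → w m = 0 := by
      intro h1 h2
      obtain ⟨w, hw, hw1, hw2⟩ := h.exists_pivot _ h2
      obtain ⟨u, hu, hu1, hu2⟩ := h.exists_pivot _ h1
      refine ⟨w - w i.castSucc • u, Submodule.sub_mem _ hw (Submodule.smul_mem _ _ hu), ?_, ?_, ?_⟩
      · simp [hu1]
      · simp [hw1, hu2 _ hlt]
      · intro m hm
        simp [hw2 m hm, hu2 m (hlt.trans hm)]
    by_cases hj1 : j = i.castSucc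
    · subst hj1
      rw [e1] at hj
      obtain ⟨w, hw, hw0, hw1, hw2⟩ := both (hP hj) hj
      obtain ⟨u, hu, hu1, hu2⟩ := h.exists_pivot _ (hP hj)
      -- Multiplication by x_i(a) adds `a` to the entry of `u` at i+1; subtracting `a • w` cancels
      -- it.
      refine ⟨_, span (u - a • w) (Submodule.sub_mem _ hu (Submodule.smul_mem _ _ hw)), ?_, ?_⟩
      · simp [vecMul_elemUnip_apply, hlt.ne, hu1, hw0]
      · intro m hm
        rw [vecMul_elemUnip_apply]
        by_cases hm' : m = i.succ
        · simp [hm', hu1, hw0, hw1, hu2 _ hlt]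
        · simp [hm', hu2 _ hm, hw2 _ (gt hm hm')]
    · by_cases hj2 : j = i.succ
      · subst hj2
        rw [e2] at hj
        by_cases hs : P i.succ
        · obtain ⟨w, hw, hw0, hw1, hw2⟩ := both hj hs
          refine ⟨_, span w hw, ?_, fun m hm => ?_⟩
          · simp [vecMul_elemUnip_apply, hw0, hw1]
          · simp [vecMul_elemUnip_apply, hm.ne', hw2 m hm]
        · obtain ⟨u, hu, hu1, hu2⟩ := h.exists_pivot _ hj
          refine ⟨_, span (b • u) (Submodule.smul_mem _ _ hu), ?_, fun m hm => ?_⟩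
          · simp [vecMul_elemUnip_apply, hu1, hu2 _ hlt, hb]
          · simp [vecMul_elemUnip_apply, hm.ne', hu2 m (hlt.trans hm)]
      · rw [out j hj1 hj2] at hj
        obtain ⟨w, hw, hw1, hw2⟩ := h.exists_pivot _ hj
        refine ⟨_, span w hw, ?_, fun m hm => ?_⟩
        · simp [vecMul_elemUnip_apply, hj2, hw1]
        · rw [vecMul_elemUnip_apply, hw2 m hm]
          split_ifs with h'
          · subst h'
            have : j < i.castSucc :=
              lt_of_le_of_ne (Fin.le_castSucc_iff.2 hm) hj1
            simp [hw2 _ this]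
          · simp
  · intro j hj w hw hz
    obtain ⟨w, hw', rfl⟩ := mem_rowSpan_mul_iff.1 hw
    simp only [vecMul_elemUnip_apply] at hz ⊢
    have big : ∀ m, i.succ < m → j < m → w m = 0 := fun m hm hjm => by
      simpa [hm.ne'] using hz m hjm
    by_cases hj1 : j = i.castSucc
    · subst hj1
      rw [e1] at hj
      have h1 : w i.succ = 0 := h.eq_zero _ hj w hw' fun m hm => big m hm (hlt.trans hm)
      have h2 := hz _ hlt
      rw [h1, if_pos rfl, zero_add] at h2
      simpa [hlt.ne] using (ha.mul_left_eq_zero).1 h2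
    · by_cases hj2 : j = i.succ
      · subst hj2
        rw [e2] at hj
        have h1 : w i.succ = 0 := h.eq_zero _ (fun h' => hj (hP h')) w hw' fun m hm => big m hm hm
        have h2 : w i.castSucc = 0 := h.eq_zero _ hj w hw' fun m hm => by
          by_cases hm' : m = i.succ
          · rw [hm', h1]
          · exact big m (gt hm hm') (gt hm hm')
        simp [h1, h2]
      · rw [out j hj1 hj2] at hj
        rw [if_neg hj2, add_zero]
        refine h.eq_zero _ hj w hw' fun m hm => ?_
        have h1 := hz m hm
        split_ifs at h1 with hm'
        · subst hm'
          have hj3 : j < i.castSucc := lt_of_le_of_ne (Fin.le_castSucc_iff.2 hm) hj1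
          have h2 := hz _ hj3
          rw [if_neg hlt.ne, add_zero] at h2
          simpa [h2] using h1
        · simpa using h1

theorem IsEchelon.exists_mem_mul_elemUnip {A : Type*} [Ring A] {n : ℕ}
    {Z : Matrix (Fin (n + 1)) (Fin (n + 1)) A} {k : ℕ} {P : Fin (n + 1) → Prop}
    (h : IsEchelon (rowSpan Z k) P) {i : Fin n} (hi : P i.castSucc) (a : A) :
    ∃ w ∈ rowSpan (Z * elemUnip i a) k,
      w i.castSucc = 1 ∧ w i.succ = a ∧ ∀ m, i.succ < m → w m = 0 := by
  have hlt := i.castSucc_lt_succ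
  obtain ⟨u, hu, hu1, hu2⟩ := h.exists_pivot _ hi
  refine ⟨_, mem_rowSpan_mul_iff.2 ⟨u, hu, rfl⟩, ?_, ?_, fun m hm => ?_⟩
  · simp [vecMul_elemUnip_apply, hlt.ne, hu1]
  · simp [vecMul_elemUnip_apply, hu1, hu2 _ hlt]
  · simp [vecMul_elemUnip_apply, hm.ne', hu2 m (hlt.trans hm)]

/-- Before the last factor such a vector is zero at i+1, as that column has no pivot; its entry
there comes entirely from column i. -/
theorem IsEchelon.mul_eq_of_mem {A : Type*} [Ring A] {n : ℕ}
    {Z : Matrix (Fin (n + 1)) (Fin (n + 1)) A} {k : ℕ} {P : Fin (n + 1) → Prop}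
    (h : IsEchelon (rowSpan Z k) P) {i : Fin n} (hi : ¬ P i.succ) {a : A} {w : Fin (n + 1) → A}
    (hw : w ∈ rowSpan (Z * elemUnip i a) k) (hz : ∀ m, i.succ < m → w m = 0) :
    w i.castSucc * a = w i.succ := by
  have hlt := i.castSucc_lt_succ
  obtain ⟨u, hu, rfl⟩ := mem_rowSpan_mul_iff.1 hw
  simp only [vecMul_elemUnip_apply] at hz ⊢
  have : u i.succ = 0 := h.eq_zero _ hi u hu fun m hm => by simpa [hm.ne'] using hz m hm
  simp [hlt.ne, this]

/-! ### Reduced words ascend. -/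

/-- Each letter of the word increases the length of the product of its predecessors. -/
def IsAscending {n : ℕ} (ω : List (Fin n)) : Prop :=
  ∀ ω' i, ω' ++ [i] <+: ω →
    (ω'.map simpleTransp).prod i.castSucc < (ω'.map simpleTransp).prod i.succ

theorem IsAscending.of_concat {n : ℕ} {ω : List (Fin n)} {i : Fin n}
    (h : IsAscending (ω ++ [i])) : IsAscending ω := fun ω' j hj =>
  h ω' j (hj.trans (List.prefix_append _ _))

theorem IsAscending.lt_of_concat {n : ℕ} {ω : List (Fin n)} {i : Fin n}
    (h : IsAscending (ω ++ [i])) :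
    (ω.map simpleTransp).prod i.castSucc < (ω.map simpleTransp).prod i.succ :=
  h ω i List.prefix_rfl

/-- The exchange property. Reading from the right, some letter reverses the order of the images of
`x` and `y`; deleting it multiplies the product by the transposition. -/
theorem exists_shorter_mul_swap {n : ℕ} (ω : List (Fin n)) {x y : Fin (n + 1)} (hxy : x < y)
    (h : (ω.map simpleTransp).prod y < (ω.map simpleTransp).prod x) :
    ∃ ω' : List (Fin n), ω'.length + 1 = ω.length ∧
      (ω'.map simpleTransp).prod = (ω.map simpleTransp).prod * Equiv.swap x y := by
  induction ω using List.reverseRecOn generalizing x y with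
  | nil => simp at h; omega
  | append_singleton ω j ih =>
    simp only [List.map_append, List.prod_append, List.map_cons, List.map_nil, List.prod_singleton]
      at h ⊢
    rw [Equiv.Perm.mul_apply, Equiv.Perm.mul_apply] at h
    by_cases hj : x = j.castSucc ∧ y = j.succ
    · refine ⟨ω, by simp, ?_⟩
      rw [hj.1, hj.2, simpleTransp, mul_assoc, Equiv.swap_mul_self, mul_one]
    · have hlt : simpleTransp j x < simpleTransp j y := by
        simp only [simpleTransp, Equiv.swap_apply_def]
        simp only [Fin.ext_iff, Fin.lt_def, Fin.val_castSucc, Fin.val_succ] at *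
        split_ifs <;> simp <;> omega
      obtain ⟨ω', h1, h2⟩ := ih hlt h
      refine ⟨ω' ++ [j], by simp [h1], ?_⟩
      simp only [List.map_append, List.prod_append, List.map_cons, List.map_nil,
        List.prod_singleton, h2]
      rw [mul_assoc, mul_assoc, Equiv.swap_apply_apply]
      simp [mul_assoc, simpleTransp]

theorem IsReducedExpr.isAscending {n : ℕ} {ω : List (Fin n)} {w : Equiv.Perm (Fin (n + 1))}
    (h : IsReducedExpr ω w) : IsAscending ω := by
  rintro ω₁ i ⟨ω₂, rfl⟩
  by_contra hlt
  have hne : (ω₁.map simpleTransp).prod i.castSucc ≠ (ω₁.map simpleTransp).prod i.succ :=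
    fun h => i.castSucc_lt_succ.ne (Equiv.injective _ h)
  obtain ⟨ω', h1, h2⟩ := exists_shorter_mul_swap ω₁ i.castSucc_lt_succ
    (lt_of_le_of_ne (not_lt.1 hlt) hne.symm)
  have := h.2 (ω' ++ ω₂) (by
    rw [← h.1]
    simp [h2, simpleTransp, mul_assoc])
  simp at this
  omega

/-! ### The last coordinate and uniqueness of the factorization. -/

theorem isEchelon_mul_chainProd {A : Type*} [Ring A] {n : ℕ} {v : Fin n → A}
    (hv : ∀ i, IsUnit (v i)) (L : List (Fin n × A)) (hL : ∀ x ∈ L, IsUnit x.2)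
    (hω : IsAscending (L.map Prod.fst)) (k : ℕ) :
    IsEchelon (rowSpan (torusPlus v * chainProd L) k)
      fun j => (((L.map Prod.fst).map simpleTransp).prod j : ℕ) < k := by
  induction L using List.reverseRecOn with
  | nil => simpa [chainProd] using isEchelon_torusPlus hv k
  | append_singleton L x ih =>
    rw [List.map_append, List.map_singleton] at hω
    have h := ih (fun y hy => hL y (by simp [hy])) hω.of_concat
    rw [chainProd_concat, ← mul_assoc]
    convert h.mul_elemUnip (i := x.1) (fun h' => lt_trans hω.lt_of_concat h') (hL x (by simp))
      using 2
    simp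

theorem exists_rows_extracting_last {A : Type*} [Ring A] {n : ℕ} {v : Fin n → A}
    (hv : ∀ i, IsUnit (v i)) {L : List (Fin n × A)} (hL : ∀ x ∈ L, IsUnit x.2) {i : Fin n}
    (hω : IsAscending (L.map Prod.fst ++ [i])) :
    ∃ (k : ℕ) (P : Fin (n + 1) → Prop), P i.castSucc ∧ ¬ P i.succ ∧
      IsEchelon (rowSpan (torusPlus v * chainProd L) k) P :=
  -- With π the prefix permutation, k = π(i)+1 separates the columns: π(i) < k ≤ π(i+1).
  ⟨((L.map Prod.fst).map simpleTransp).prod i.castSucc + 1,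
    fun j => (((L.map Prod.fst).map simpleTransp).prod j : ℕ) <
      ((L.map Prod.fst).map simpleTransp).prod i.castSucc + 1,
    Nat.lt_succ_self _, not_lt.2 hω.lt_of_concat,
    isEchelon_mul_chainProd hv L hL hω.of_concat _⟩

/-- The last coordinate is read off from a row span, which depends only on the matrix; then the last
factor is cancelled. -/
theorem torusPlus_mul_chainProd_inj {A : Type*} [Ring A] {n : ℕ} {v v' : Fin n → A}
    (hv : ∀ i, IsUnit (v i)) (hv' : ∀ i, IsUnit (v' i)) (f : Fin n × A → A)
    (L : List (Fin n × A)) (hL : ∀ x ∈ L, IsUnit x.2) (hf : ∀ x ∈ L, IsUnit (f x))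
    (hω : IsAscending (L.map Prod.fst))
    (h : torusPlus v * chainProd L = torusPlus v' * chainProd (L.map fun x => (x.1, f x))) :
    v = v' ∧ ∀ x ∈ L, x.2 = f x := by
  induction L using List.reverseRecOn with
  | nil =>
    refine ⟨funext fun i => ?_, by simp⟩
    have := congrFun (congrFun h i.succ) i.succ
    simpa [chainProd, torusPlus_apply] using this
  | append_singleton L x ih =>
    rw [List.map_append, List.map_singleton] at hω
    rw [List.map_append, List.map_singleton, chainProd_concat, chainProd_concat, ← mul_assoc,
      ← mul_assoc] at h
    have hL' : ∀ y ∈ L, IsUnit y.2 := fun y hy => hL y (by simp [hy])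
    have hf' : ∀ y ∈ L, IsUnit (f y) := fun y hy => hf y (by simp [hy])
    have hx : x.2 = f x := by
      let P := fun j => (((L.map Prod.fst).map simpleTransp).prod j : ℕ) <
        ((L.map Prod.fst).map simpleTransp).prod x.1.castSucc + 1
      have h1 := isEchelon_mul_chainProd hv L hL' hω.of_concat
        (((L.map Prod.fst).map simpleTransp).prod x.1.castSucc + 1)
      have h2 := isEchelon_mul_chainProd hv' (L.map fun x => (x.1, f x)) 
        (fun y hy => by
          obtain ⟨z, hz, rfl⟩ := List.mem_map.1 hy
          exact hf' z hz)
        (by simpa [Function.comp_def] using hω.of_concat)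
        (((L.map Prod.fst).map simpleTransp).prod x.1.castSucc + 1)
      obtain ⟨w, hw, w1, w2, w3⟩ := h1.exists_mem_mul_elemUnip (Nat.lt_succ_self _) x.2
      rw [h] at hw
      have h3 := h2.mul_eq_of_mem (not_lt.2 (by
        simpa [Function.comp_def, Nat.succ_le_iff] using hω.lt_of_concat)) hw w3
      rw [← w2, ← h3, w1, one_mul]
    have h' : torusPlus v * chainProd L = torusPlus v' * chainProd (L.map fun x => (x.1, f x)) := by
      have := congrArg (· * elemUnip x.1 (-x.2)) h
      simpa only [← hx, mul_assoc, elemUnip_mul_neg, mul_one] using this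
    obtain ⟨e1, e2⟩ := ih hL' hf' hω.of_concat h'
    refine ⟨e1, fun y hy => ?_⟩
    rcases List.mem_append.1 hy with hy | hy
    · exact e2 y hy
    · rw [List.mem_singleton.1 hy, hx]

/-! ### Necessity of the relations, and the induction on the word. -/

theorem IsGLqMatrix.mul_last_eq {A : Type*} [Ring A] [Algebra ℂ A] {q : ℂ} (hq : q ≠ 0) {n : ℕ}
    {Z : Matrix (Fin (n + 1)) (Fin (n + 1)) A} {i : Fin n} {a : A}
    (hZ : IsGLqMatrix q (Z * elemUnip i a)) {k : ℕ} {P : Fin (n + 1) → Prop}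
    (h : IsEchelon (rowSpan Z k) P) (h1 : P i.castSucc) (h2 : ¬ P i.succ) (m c : Fin (n + 1)) :
    a * Z m c = Z m c * colWeight q i a c := by
  have hlt := i.castSucc_lt_succ
  obtain ⟨w, hw, w1, w2, w3⟩ := h.exists_mem_mul_elemUnip h1 a
  have e : ∀ c, c ≠ i.succ → (Z * elemUnip i a) m c = Z m c := fun c hc => by
    simp [mul_elemUnip_apply, hc]
  -- The transformed vector still vanishes right of i+1: there `w l = 0`, and the correction term
  -- occurs only for `l < c`, where `w c = 0` too.
  have key := fun c => h.mul_eq_of_mem h2 (hZ.mem_rowSpan m c hw) fun l hl => by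
    rw [w3 l hl]
    split_ifs with hc
    · simp [w3 c (hl.trans hc)]
    · simp
  have comm : ∀ c, c ≠ i.succ → a * Z m c = Z m c * a := by
    intro c hc
    have := key c
    simp only [w1, w2] at this
    rw [e c hc] at this
    rcases lt_or_gt_of_ne hc with hc | hc
    · have : c ≤ i.castSucc := Fin.le_castSucc_iff.2 hc
      simp_all [this.not_gt, hc.not_gt]
    · rw [w3 c hc] at this
      simp only [hc, hlt.trans hc, if_true, one_mul, zero_mul, smul_zero, sub_zero,
        smul_mul_assoc] at this
      exact (smul_right_injective A (pow_ne_zero 2 hq) this).symm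
  by_cases hc : c = i.succ
  · subst hc
    have := key i.succ
    simp only [w1, w2, hlt, lt_irrefl, if_true, if_false] at this
    rw [e _ hlt.ne, mul_elemUnip_apply, if_pos rfl, comm _ hlt.ne] at this
    simp only [colWeight, if_true]
    simp only [one_mul, one_smul, zero_smul, sub_zero, mul_add, ← mul_assoc, comm _ hlt.ne,
      smul_mul_assoc, sub_mul, add_mul, mul_smul_comm] at this ⊢
    linear_combination (norm := module) -this
  · rw [comm c hc, colWeight, if_neg hc]

theorem colWeight_isUnit {A : Type*} [Ring A] [Algebra ℂ A] {q : ℂ} (hq : q ≠ 0) {n : ℕ}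
    (i : Fin n) {a : A} (ha : IsUnit a) (j : Fin (n + 1)) : IsUnit (colWeight q i a j) := by
  rw [colWeight]
  split_ifs
  · rw [Algebra.smul_def]
    exact ((IsUnit.mk0 _ (pow_ne_zero 2 hq)).map (algebraMap ℂ A)).mul ha
  · exact ha

theorem elemUnip_mul_diagonal {A : Type*} [Ring A] {n : ℕ} {e e' : Fin (n + 1) → A}
    (he : ∀ j, e j * e' j = 1) (i : Fin n) (b : A) :
    elemUnip i b * Matrix.diagonal e =
      Matrix.diagonal e * elemUnip i (e' i.castSucc * b * e i.succ) := by
  ext k l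
  rw [Matrix.mul_diagonal, Matrix.diagonal_mul, elemUnip_apply, elemUnip_apply, add_mul, mul_add]
  congr 1
  · split_ifs with h <;> simp [h]
  · split_ifs <;> simp_all [← mul_assoc]

theorem chainProd_mul_diagonal {A : Type*} [Ring A] {n : ℕ} {e e' : Fin (n + 1) → A}
    (he : ∀ j, e j * e' j = 1) (L : List (Fin n × A)) :
    chainProd L * Matrix.diagonal e =
      Matrix.diagonal e *
        chainProd (L.map fun x => (x.1, e' x.1.castSucc * x.2 * e x.1.succ)) := by
  induction L with
  | nil => simp [chainProd]
  | cons x L ih =>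
    simp only [chainProd, List.map_cons, List.prod_cons] at ih ⊢
    rw [mul_assoc, ih, ← mul_assoc, elemUnip_mul_diagonal he, mul_assoc]

/-- With D the diagonal of column weights, the hypothesis says M = a⁻¹MD. Pulling D left through the
unipotent factors gives a second factorization of M along the same word, and uniqueness equates the
coordinates. -/
theorem relations_of_mul_eq_colWeight {A : Type*} [Ring A] [Algebra ℂ A] {q : ℂ} (hq : q ≠ 0)
    {n : ℕ} {v : Fin n → A} (hv : ∀ i, IsUnit (v i)) {L : List (Fin n × A)}
    (hL : ∀ x ∈ L, IsUnit x.2) (hω : IsAscending (L.map Prod.fst)) {i : Fin n} {a : A}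
    (ha : IsUnit a)
    (h : ∀ k j, a * (torusPlus v * chainProd L) k j =
      (torusPlus v * chainProd L) k j * colWeight q i a j) :
    (∀ j, a * v j = v j * colWeight q i a j.succ) ∧
      ∀ y ∈ L, y.2 * colWeight q i a y.1.succ = colWeight q i a y.1.castSucc * y.2 := by
  have hu := colWeight_isUnit hq i ha
  obtain ⟨u, rfl⟩ := ha
  let e' : Fin (n + 1) → A := fun j => ↑(hu j).unit⁻¹
  have he : ∀ j, colWeight q i (u : A) j * e' j = 1 := fun j => (hu j).mul_val_inv
  have hu' : ∀ j, IsUnit (e' j) := fun j => Units.isUnit _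
  have hmat : torusPlus v * chainProd L =
      torusPlus (fun j => ↑u⁻¹ * v j * colWeight q i (u : A) j.succ) *
        chainProd (L.map fun x =>
          (x.1, e' x.1.castSucc * x.2 * colWeight q i (u : A) x.1.succ)) := by
    have h1 : torusPlus (fun j => ↑u⁻¹ * v j * colWeight q i (u : A) j.succ) =
        Matrix.diagonal (fun _ => (↑u⁻¹ : A)) * torusPlus v *
          Matrix.diagonal (colWeight q i (u : A)) := by
      ext k j
      rw [Matrix.mul_diagonal, Matrix.diagonal_mul, torusPlus_apply, torusPlus_apply]
      split_ifs
      · cases j using Fin.cases with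
        | zero => simp [colWeight, (Fin.succ_ne_zero i).symm]
        | succ j => simp
      · simp
    rw [h1, mul_assoc, ← chainProd_mul_diagonal he, mul_assoc, ← mul_assoc (torusPlus v)]
    ext k j
    rw [Matrix.diagonal_mul, Matrix.mul_diagonal, ← h, ← mul_assoc, Units.inv_mul, one_mul]
  obtain ⟨r1, r2⟩ := torusPlus_mul_chainProd_inj hv
    (fun j => ((Units.isUnit u⁻¹).mul (hv j)).mul (hu _)) _ L hL
    (fun x hx => ((hu' _).mul (hL x hx)).mul (hu _)) hω hmat
  refine ⟨fun j => ?_, fun y hy => ?_⟩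
  · have := congrArg ((u : A) * ·) (congrFun r1 j)
    simpa only [← mul_assoc, Units.mul_inv, one_mul] using this
  · have := congrArg (colWeight q i (u : A) y.1.castSucc * ·) (r2 y hy)
    simp only [← mul_assoc, he, one_mul] at this
    exact this.symm

theorem isGLqMatrix_iff_listArrowRel {A : Type*} [Ring A] [Algebra ℂ A] {q : ℂ} (hq : q ≠ 0)
    {n : ℕ} {v : Fin n → A} (hv : ∀ i, IsUnit (v i)) (L : List (Fin n × A))
    (hL : ∀ x ∈ L, IsUnit x.2) (hω : IsAscending (L.map Prod.fst)) :
    IsGLqMatrix q (torusPlus v * chainProd L) ↔ ListArrowRel q v L := by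
  induction L using List.reverseRecOn with
  | nil =>
    simp only [chainProd, List.map_nil, List.prod_nil, mul_one]
    constructor
    · intro h
      refine ⟨fun i j => ?_, by simp, by simp⟩
      wlog hij : i < j generalizing i j
      · rcases (not_lt.1 hij).eq_or_lt with h' | h'
        · rw [h']
        · exact (this j i h').symm
      have := (h i.succ j.succ i.succ j.succ (by simpa) (by simpa)).det
      simpa [torusPlus_apply, hij.ne, hij.ne'] using this
    · intro h k l j j' hkl hj
      have comm : ∀ i j, (Fin.cons (1 : A) v : Fin (n + 1) → A) i *
          (Fin.cons (1 : A) v : Fin (n + 1) → A) j =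
          (Fin.cons (1 : A) v : Fin (n + 1) → A) j *
            (Fin.cons (1 : A) v : Fin (n + 1) → A) i := by
        intro i j
        cases i using Fin.cases <;> cases j using Fin.cases <;> simp [h.tor]
      constructor <;> simp only [torusPlus_apply] <;> split_ifs <;>
        first
          | omega
          | simp [comm]
  | append_singleton L x ih =>
    rw [List.map_append, List.map_singleton] at hω
    have hL' : ∀ y ∈ L, IsUnit y.2 := fun y hy => hL y (by simp [hy])
    have ih := ih hL' hω.of_concat
    rw [listArrowRel_concat, ← ih, chainProd_concat, ← mul_assoc]
    constructor
    · intro h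
      obtain ⟨k, P, h1, h2, hP⟩ := exists_rows_extracting_last hv hL' hω
      have hM := h.mul_last_eq hq hP h1 h2
      exact ⟨(isGLqMatrix_mul_elemUnip_iff hM).1 h,
        relations_of_mul_eq_colWeight hq hv hL' hω.of_concat (hL x (by simp)) hM⟩
    · rintro ⟨h, h1, h2⟩
      exact (isGLqMatrix_mul_elemUnip_iff (mul_chainProd_eq_mul_colWeight h1 L h2)).2 h

/-! ### From lists to labelled coordinates. -/

theorem unipProd_eq_chainProd {A : Type*} [Ring A] {n : ℕ} (ω : List (Fin n))
    (a : Fin ω.length → A) :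
    unipProd ω a = chainProd (List.ofFn fun p : Fin ω.length => (ω.get p, a p)) := by
  rw [unipProd, chainProd, List.map_ofFn]
  rfl

theorem ArrowRel.symm {A : Type*} [Ring A] [Algebra ℂ A] {q : ℂ} {n : ℕ} {ω : List (Fin n)}
    {v : Fin n → A} {a : Fin ω.length → A} {x y : Coord ω} (h : ArrowRel q v a x y) :
    ArrowRel q v a y x :=
  ⟨h.2.1, h.1, fun h1 h2 => (h.2.2 h2 h1).symm⟩

theorem arrowRel_tor_tor_iff {A : Type*} [Ring A] [Algebra ℂ A] {q : ℂ} {n : ℕ}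
    {ω : List (Fin n)} {v : Fin n → A} {a : Fin ω.length → A} {i j : Fin n} :
    ArrowRel q v a (.tor i) (.tor j) ↔ v i * v j = v j * v i := by
  simp [ArrowRel, Coord.Arrow, Coord.val]

theorem arrowRel_unip_self {A : Type*} [Ring A] [Algebra ℂ A] {q : ℂ} {n : ℕ}
    {ω : List (Fin n)} {v : Fin n → A} {a : Fin ω.length → A} {p : Fin ω.length} :
    ArrowRel q v a (.unip p) (.unip p) := by
  simp [ArrowRel, Coord.Arrow]

theorem arrowRel_unip_tor_iff {A : Type*} [Ring A] [Algebra ℂ A] {q : ℂ} {n : ℕ}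
    {ω : List (Fin n)} {v : Fin n → A} {a : Fin ω.length → A} {p : Fin ω.length} {j : Fin n} :
    ArrowRel q v a (.unip p) (.tor j) ↔
      a p * v j = v j * colWeight q (ω.get p) (a p) j.succ := by
  simp only [ArrowRel, Coord.Arrow, Coord.val, colWeight, Fin.succ_inj]
  generalize ω.get p = i
  by_cases h : i = j
  · simp [h]
  · simp [h, Ne.symm h]

theorem arrowRel_unip_unip_iff {A : Type*} [Ring A] [Algebra ℂ A] {q : ℂ} {n : ℕ}
    {ω : List (Fin n)} {v : Fin n → A} {a : Fin ω.length → A} {p r : Fin ω.length} (h : p < r) :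
    ArrowRel q v a (.unip p) (.unip r) ↔
      a p * colWeight q (ω.get r) (a r) (ω.get p).succ =
        colWeight q (ω.get r) (a r) (ω.get p).castSucc * a p := by
  have e : (ω.get p).castSucc = (ω.get r).succ ↔ (ω.get p : ℕ) = ω.get r + 1 := by
    simp [Fin.ext_iff]
  simp only [ArrowRel, Coord.Arrow, Coord.val, colWeight, Fin.succ_inj, h, h.not_gt, e]
  clear e
  generalize ω.get p = i
  generalize ω.get r = j
  by_cases h1 : i = j
  · simp [h1, eq_comm]
  · by_cases h2 : (i : ℕ) = j + 1 <;> simp [h1, h2]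

theorem listArrowRel_ofFn_iff {A : Type*} [Ring A] [Algebra ℂ A] {q : ℂ} {n : ℕ}
    {ω : List (Fin n)} {v : Fin n → A} {a : Fin ω.length → A} :
    ListArrowRel q v (List.ofFn fun p : Fin ω.length => (ω.get p, a p)) ↔
      ∀ x y : Coord ω, ArrowRel q v a x y := by
  constructor
  · rintro ⟨h1, h2, h3⟩
    rw [List.pairwise_ofFn] at h3
    have mixed : ∀ p j, ArrowRel q v a (.unip p) (.tor j) := fun p j =>
      arrowRel_unip_tor_iff.2 (h2 (ω.get p, a p) (List.mem_ofFn.2 ⟨p, rfl⟩) j)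
    rintro (i | p) (j | r)
    · exact arrowRel_tor_tor_iff.2 (h1 i j)
    · exact (mixed r i).symm
    · exact mixed p j
    · rcases lt_trichotomy p r with h | h | h
      · exact (arrowRel_unip_unip_iff h).2 (h3 h)
      · exact h ▸ arrowRel_unip_self
      · exact ((arrowRel_unip_unip_iff h).2 (h3 h)).symm
  · intro h
    refine ⟨fun i j => arrowRel_tor_tor_iff.1 (h _ _), fun x hx j => ?_, ?_⟩
    · obtain ⟨p, rfl⟩ := List.mem_ofFn.1 hx
      exact arrowRel_unip_tor_iff.1 (h _ _)
    · rw [List.pairwise_ofFn]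
      exact fun p r hpr => (arrowRel_unip_unip_iff hpr).1 (h _ _)

theorem isGLqMatrix_unipProd_iff {A : Type*} [Ring A] [Algebra ℂ A] {q : ℂ} (hq : q ≠ 0) {n : ℕ}
    {ω : List (Fin n)} (hω : IsAscending ω) {v : Fin n → A} {a : Fin ω.length → A}
    (hv : ∀ i, IsUnit (v i)) (ha : ∀ p, IsUnit (a p)) :
    IsGLqMatrix q (torusPlus v * unipProd ω a) ↔ ∀ x y : Coord ω, ArrowRel q v a x y := by
  rw [unipProd_eq_chainProd, ← listArrowRel_ofFn_iff]
  refine isGLqMatrix_iff_listArrowRel hq hv _ (fun x hx => ?_) ?_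
  · obtain ⟨p, rfl⟩ := List.mem_ofFn.1 hx
    exact ha p
  · rw [List.map_ofFn]
    convert hω
    exact List.ofFn_get ω

/-! ### Triples as the rank two case. -/

theorem isAscending_braid {i j : Fin 2} (hij : i ≠ j) : IsAscending [i, j, i] := by
  intro ω' k hk
  have h := List.prefix_iff_eq_take.1 hk
  have hlen := hk.length_le
  rw [List.length_append, List.length_singleton] at h hlen
  have hlen' : ω'.length < 3 := by simpa using hlen
  generalize hl : ω'.length = l at *
  interval_cases l
  · obtain rfl := List.length_eq_zero_iff.1 hl
    simp
  · obtain ⟨x, rfl⟩ := List.length_eq_one_iff.1 hl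
    simp only [List.take, List.cons_append, List.nil_append, List.cons.injEq, and_true] at h
    rw [h.1, h.2]
    clear * - hij
    revert i j
    decide
  · obtain ⟨x, y, rfl⟩ := List.length_eq_two.1 hl
    simp only [List.take, List.cons_append, List.nil_append, List.cons.injEq, and_true] at h
    rw [h.1, h.2.1, h.2.2]
    clear * - hij
    revert i j
    decide

/-- Arrows see letters only through equality and the successor relation, both of which the
relabelling `g` preserves and reflects. -/
theorem forall_memTriple_arrowRel_iff {A : Type*} [Ring A] [Algebra ℂ A] {q : ℂ} {n : ℕ}
    {ω : List (Fin n)} {v : Fin n → A} {a : Fin ω.length → A} {p r s : Fin ω.length}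
    (h : IsTriple ω p r s) {i j : Fin 2} (hij : ∀ k, k = i ∨ k = j) {g : Fin 2 → Fin n}
    (hi : g i = ω.get p) (hj : g j = ω.get r) (hg : Function.Injective g)
    (hsucc : ∀ k l : Fin 2, (k : ℕ) = l + 1 ↔ (g k : ℕ) = g l + 1) :
    (∀ x y : Coord ω, x.MemTriple p r s → y.MemTriple p r s → ArrowRel q v a x y) ↔
      ListArrowRel q (v ∘ g) [(i, a p), (j, a r), (i, a s)] := by
  obtain ⟨hpr, hrs, hps, -⟩ := h
  have c1 : ∀ k l (x : A), colWeight q k x l.succ = colWeight q (g k) x (g l).succ := by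
    intro k l x
    simp only [colWeight, Fin.succ_inj, hg.eq_iff]
  have c2 : ∀ k l (x : A), colWeight q k x l.castSucc = colWeight q (g k) x (g l).castSucc := by
    intro k l x
    simp only [colWeight, Fin.ext_iff, Fin.val_castSucc, Fin.val_succ, hsucc]
  have hs : g i = ω.get s := hi.trans hps
  have mem : ∀ k, Coord.MemTriple p r s (.tor (g k)) := by
    intro k
    rcases hij k with rfl | rfl
    · exact Or.inl hi
    · exact Or.inr hj
  constructor
  · intro H
    refine ⟨fun k l => (arrowRel_tor_tor_iff (a := a)).1 (H _ _ (mem k) (mem l)), ?_, ?_⟩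
    · have key : ∀ t, Coord.MemTriple p r s (.unip t) → ∀ l,
          a t * v (g l) = v (g l) * colWeight q (ω.get t) (a t) (g l).succ := fun t ht l =>
        arrowRel_unip_tor_iff.1 (H _ _ ht (mem l))
      have kp := key p (Or.inl rfl)
      have kr := key r (Or.inr (Or.inl rfl))
      have ks := key s (Or.inr (Or.inr rfl))
      rw [← hi] at kp
      rw [← hj] at kr
      rw [← hs] at ks
      simpa only [List.mem_cons, forall_eq_or_imp, List.not_mem_nil, c1, IsEmpty.forall_iff,
        implies_true, and_true] using ⟨kp, kr, ks⟩
    · have kpr := (arrowRel_unip_unip_iff hpr).1 (H _ _ (Or.inl rfl) (Or.inr (Or.inl rfl)))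
      have krs := (arrowRel_unip_unip_iff hrs).1
        (H _ _ (Or.inr (Or.inl rfl)) (Or.inr (Or.inr rfl)))
      have kps := (arrowRel_unip_unip_iff (hpr.trans hrs)).1
        (H _ _ (Or.inl rfl) (Or.inr (Or.inr rfl)))
      rw [← hi, ← hj] at kpr
      rw [← hs, ← hj] at krs
      rw [← hi, ← hs] at kps
      simpa only [List.pairwise_cons, List.mem_cons, forall_eq_or_imp, List.not_mem_nil, c1, c2,
        IsEmpty.forall_iff, implies_true, and_true, List.Pairwise.nil] using ⟨⟨kpr, kps⟩, krs⟩
  · rintro ⟨h1, h2, h3⟩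
    simp only [List.pairwise_cons, List.mem_cons, forall_eq_or_imp, List.not_mem_nil, c1, c2,
      IsEmpty.forall_iff, implies_true, and_true, List.Pairwise.nil] at h2 h3
    obtain ⟨kp, kr, ks⟩ := h2
    obtain ⟨⟨kpr, kps⟩, krs⟩ := h3
    have tor : ∀ m, Coord.MemTriple p r s (.tor m) → ∃ k, g k = m := by
      rintro m (rfl | rfl)
      · exact ⟨i, hi⟩
      · exact ⟨j, hj⟩
    have mixed : ∀ t, Coord.MemTriple p r s (.unip t) → ∀ k,
        ArrowRel q v a (.unip t) (.tor (g k)) := by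
      rintro t (rfl | rfl | rfl) k <;> rw [arrowRel_unip_tor_iff]
      · rw [← hi]
        exact kp k
      · rw [← hj]
        exact kr k
      · rw [← hs]
        exact ks k
    have upr : ArrowRel q v a (.unip p) (.unip r) := by
      rw [arrowRel_unip_unip_iff hpr, ← hi, ← hj]
      exact kpr
    have ups : ArrowRel q v a (.unip p) (.unip s) := by
      rw [arrowRel_unip_unip_iff (hpr.trans hrs), ← hi, ← hs]
      exact kps
    have urs : ArrowRel q v a (.unip r) (.unip s) := by
      rw [arrowRel_unip_unip_iff hrs, ← hj, ← hs]
      exact krs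
    rintro (m | t) (l | u) hx hy
    · obtain ⟨k, rfl⟩ := tor m hx
      obtain ⟨k', rfl⟩ := tor l hy
      exact arrowRel_tor_tor_iff.2 (h1 k k')
    · obtain ⟨k, rfl⟩ := tor m hx
      exact (mixed u hy k).symm
    · obtain ⟨k, rfl⟩ := tor l hy
      exact mixed t hx k
    · rcases hx with rfl | rfl | rfl <;> rcases hy with rfl | rfl | rfl <;>
        first
          | exact arrowRel_unip_self
          | assumption
          | exact ArrowRel.symm ‹_›

theorem isGLqMatrix_tripleMatrix_iff {A : Type*} [Ring A] [Algebra ℂ A] {q : ℂ} (hq : q ≠ 0)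
    {n : ℕ} {ω : List (Fin n)} {v : Fin n → A} {a : Fin ω.length → A} (hv : ∀ i, IsUnit (v i))
    (ha : ∀ p, IsUnit (a p)) {p r s : Fin ω.length} (h : IsTriple ω p r s) :
    IsGLqMatrix q (tripleMatrix ω v a p r s) ↔
      ∀ x y : Coord ω, x.MemTriple p r s → y.MemTriple p r s → ArrowRel q v a x y := by
  have hadj := h.2.2.2
  unfold AdjLetters at hadj
  have hcomp : ∀ i j : Fin n, v ∘ ![i, j] = ![v i, v j] := fun i j => by
    ext k
    fin_cases k <;> rfl
  have main : ∀ (i j : Fin 2) (g : Fin 2 → Fin n), i ≠ j → (∀ k, k = i ∨ k = j) →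
      g i = ω.get p → g j = ω.get r → Function.Injective g →
      (∀ k l : Fin 2, (k : ℕ) = l + 1 ↔ (g k : ℕ) = g l + 1) →
      (IsGLqMatrix q (torusPlus (v ∘ g) * unipProd [i, j, i] ![a p, a r, a s]) ↔
        ∀ x y : Coord ω, x.MemTriple p r s → y.MemTriple p r s → ArrowRel q v a x y) := by
    intro i j g hne hij hi hj hg hs
    rw [forall_memTriple_arrowRel_iff h hij hi hj hg hs, ← isGLqMatrix_iff_listArrowRel hq,
      unipProd_eq_chainProd]
    · rfl
    · exact fun k => hv _
    · simp [ha]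
    · exact isAscending_braid hne
  have inj : ∀ i j : Fin n, i ≠ j → Function.Injective ![i, j] := fun i j hij k l => by
    fin_cases k <;> fin_cases l <;> simp [hij, hij.symm]
  have succ : ∀ i j : Fin n, (j : ℕ) = i + 1 → ∀ k l : Fin 2, (k : ℕ) = l + 1 ↔
      ((![i, j] : Fin 2 → Fin n) k : ℕ) = (![i, j] : Fin 2 → Fin n) l + 1 := fun i j hij k l => by
    fin_cases k <;> fin_cases l <;> simp [hij] <;> omega
  rw [tripleMatrix]
  split_ifs with hlt
  · rw [← hcomp]
    have hs : (ω.get p : ℕ) = ω.get r + 1 := by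
      rw [Fin.lt_def] at hlt
      omega
    exact main 1 0 _ (by decide) (by decide) rfl rfl (inj _ _ hlt.ne) (succ _ _ hs)
  · rw [← hcomp]
    have hs : (ω.get r : ℕ) = ω.get p + 1 := by
      rw [Fin.lt_def] at hlt
      omega
    exact main 0 1 _ (by decide) (by decide) rfl rfl (inj _ _ (by
      rw [ne_eq, Fin.ext_iff]
      omega)) (succ _ _ hs)

theorem mainTheorem5 (n : ℕ) (ω : List (Fin n))
    (hω : IsReducedExpr ω (Fin.revPerm : Equiv.Perm (Fin (n + 1))))
    (q : ℂ) (hq0 : q ≠ 0) (hq : ∀ m : ℕ, 0 < m → q ^ m ≠ 1)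
    {A : Type*} [Ring A] [Algebra ℂ A] (v : Fin n → A) (a : Fin ω.length → A)
    (hv : ∀ i, IsUnit (v i)) (ha : ∀ p, IsUnit (a p)) :
    (IsGLqMatrix q (torusPlus v * unipProd ω a) ↔
      (∀ p r s : Fin ω.length, IsTriple ω p r s → IsGLqMatrix q (tripleMatrix ω v a p r s)) ∧
      (∀ x y : Coord ω,
        (¬ ∃ p r s : Fin ω.length, IsTriple ω p r s ∧ x.MemTriple p r s ∧ y.MemTriple p r s) →
        ArrowRel q v a x y)) ∧
    (IsGLqMatrix q (torusPlus v * unipProd ω a) ↔ ∀ x y : Coord ω, ArrowRel q v a x y) ∧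
    (∀ p r s : Fin ω.length, IsTriple ω p r s →
      (IsGLqMatrix q (tripleMatrix ω v a p r s) ↔
        ∀ x y : Coord ω, x.MemTriple p r s → y.MemTriple p r s → ArrowRel q v a x y)) := by
  have h2 := isGLqMatrix_unipProd_iff hq0 hω.isAscending hv ha
  have h3 := fun p r s (h : IsTriple ω p r s) => isGLqMatrix_tripleMatrix_iff hq0 hv ha h
  refine ⟨h2.trans ⟨fun h => ⟨fun p r s ht => (h3 p r s ht).2 fun x y _ _ => h x y,
    fun x y _ => h x y⟩, fun h x y => ?_⟩, h2, h3⟩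
  by_cases hxy : ∃ p r s : Fin ω.length, IsTriple ω p r s ∧ x.MemTriple p r s ∧ y.MemTriple p r s
  · obtain ⟨p, r, s, ht, hx, hy⟩ := hxy
    exact (h3 p r s ht).1 (h.1 p r s ht) x y hx hy
  · exact h.2 x y hxy
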